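/- Let $p<q$ be relatively prime positive integers such that $p+q$ is odd. For a positive integer $n$, let $\Pi(p,q,n)$ be the graph with vertex set $\{0,1,\ldots,n-1\}$ in which two vertices $u$ and $v$ are joined by an edge if and only if $|u-v|=p$ or $|u-v|=q$. Then $\Pi(p,q,n)$ is Hamiltonian (that is, it contains a cycle visiting every vertex exactly once) for all sufficiently large positive integers $n$. Moreover, let $\mu_\Pi$ be the smallest positive integer such that $\Pi(p,q,n)$ is Hamiltonian for all integers $n\ge\mu_\Pi$. Then $\mu_\Pi<6q^2$. -/

import Mathlib

/-- The projection graph `Π(p, q, n)`: its vertices are the integers `0, 1, …, n - 1`, and two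
distinct vertices are joined by an edge when they differ by either `p` or `q`. (For positive
`p` and `q`, the condition `u ≠ v` is automatic.) -/
def projectionGraph (p q n : ℕ) : SimpleGraph (Fin n) where
  Adj u v := u ≠ v ∧ (|((u : ℕ) : ℤ) - ((v : ℕ) : ℤ)| = (p : ℤ) ∨
    |((u : ℕ) : ℤ) - ((v : ℕ) : ℤ)| = (q : ℤ))
  symm := ⟨fun u v h => ⟨h.1.symm, by
    rw [abs_sub_comm ((v : ℕ) : ℤ) ((u : ℕ) : ℤ)]
    exact h.2⟩⟩
  loopless := ⟨fun _ h => h.1 rfl⟩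

/-- The positive integers `m` such that `Π(p, q, n)` is Hamiltonian for all `n ≥ m`.
The least element of this set, when it exists, is `μ_Π`. -/
def hamiltonianThresholds (p q : ℕ) : Set ℕ :=
  {m | 0 < m ∧ ∀ n : ℕ, m ≤ n → (projectionGraph p q n).IsHamiltonian}

/-! Work in the graph on all integers with steps `p` and `q`. If `I` is closed under subtracting `p`
and `q`, its maximal elements modulo `p + q` form a cycle: `v + p` and `v - q` agree modulo `p + q`,
and `p` is invertible there (`hasCycleOn_topLayer`). Cycles on successive layers merge across
four-cycles (`HasCornerCycle.of_hasCycleOn`).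

Let `S` be the semigroup generated by `p` and `q`, and `F = p * q - p - q` its Frobenius number. A
row with an even number of vertices can be laid over alternate edges of a run at the corner `C`, and
one further layer restores the alternate edges of both runs (`HasCornerCycle.row_step`). Adding rows
and columns, always of even size, raises `C - m` to at least `F`; the piece is then exactly the set
of `v ≥ 0` with `C - v ∈ S` (`exists_hasCornerCycle`).

One of the steps is even, say `2 * r`, the other an odd `f`. From here on the corner can be moved by
any even element of `S` (`HasFullCornerCycle.add_even_combination`). Since `x ∈ S` exactly when `F -
x ∉ S`, the complement of `C - S` is a half-turned copy of such a set, so pieces with corners `C`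
and `D` tile an interval of length `C + D + 1 - F` and merge (`HasFullCornerCycle.glue`). Even moves
give one parity of the length; one extra layer moves a corner by the odd number `p + q` and gives
the other. -/

/-! ### Lists as paths and cycles. -/

/-- The unordered pairs of consecutive entries of a list. -/
def consecutivePairs {α : Type*} : List α → Set (Sym2 α)
  | [] => ∅
  | [_] => ∅
  | x :: y :: t => insert s(x, y) (consecutivePairs (y :: t))

/-- The pair formed by the last entry of one list and the first entry of another. -/
def jointPair {α : Type*} (l₁ l₂ : List α) : Set (Sym2 α) :=
  {e | ∃ x ∈ l₁.getLast?, ∃ y ∈ l₂.head?, e = s(x, y)}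

/-- The unordered pairs of cyclically consecutive entries of a list. -/
def cyclicPairs {α : Type*} (l : List α) : Set (Sym2 α) :=
  consecutivePairs l ∪ jointPair l l

section Lists

variable {α : Type*}

theorem jointPair_comm_reverse (l₁ l₂ : List α) :
    jointPair l₂.reverse l₁.reverse = jointPair l₁ l₂ := by
  ext e
  simp only [jointPair, List.getLast?_reverse, List.head?_reverse, Set.mem_ofPred_eq]
  constructor
  · rintro ⟨x, hx, y, hy, rfl⟩
    exact ⟨y, hy, x, hx, Sym2.eq_swap⟩
  · rintro ⟨x, hx, y, hy, rfl⟩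
    exact ⟨y, hy, x, hx, Sym2.eq_swap⟩

theorem consecutivePairs_append (l₁ l₂ : List α) :
    consecutivePairs (l₁ ++ l₂) =
      consecutivePairs l₁ ∪ consecutivePairs l₂ ∪ jointPair l₁ l₂ := by
  induction l₁ with
  | nil => simp [consecutivePairs, jointPair]
  | cons x t ih =>
    cases t with
    | nil =>
      cases l₂ with
      | nil => simp [consecutivePairs, jointPair]
      | cons y s =>
        ext e
        simp [consecutivePairs, jointPair]
    | cons y s =>
      have h : jointPair (x :: y :: s) l₂ = jointPair (y :: s) l₂ := by
        simp [jointPair, List.getLast?_cons_cons]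
      rw [h]
      change insert s(x, y) (consecutivePairs ((y :: s) ++ l₂)) = _
      rw [ih]
      simp only [consecutivePairs, Set.insert_union]

theorem consecutivePairs_reverse (l : List α) :
    consecutivePairs l.reverse = consecutivePairs l := by
  induction l with
  | nil => rfl
  | cons x t ih =>
    have h := consecutivePairs_append [x] t
    simp only [List.singleton_append] at h
    rw [h, List.reverse_cons, consecutivePairs_append, ih,
      ← jointPair_comm_reverse [x] t]
    simp [consecutivePairs]

theorem cyclicPairs_append_comm (l₁ l₂ : List α) :
    cyclicPairs (l₁ ++ l₂) = cyclicPairs (l₂ ++ l₁) := by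
  rcases l₁ with _ | ⟨x, s⟩
  · simp
  rcases l₂ with _ | ⟨y, t⟩
  · simp
  have h : ∀ u v : List α, u ≠ [] → v ≠ [] →
      jointPair (u ++ v) (u ++ v) = jointPair v u := by
    intro u v hu hv
    unfold jointPair
    rw [List.getLast?_append_of_ne_nil _ hv, List.head?_append_of_ne_nil _ hu]
  rw [cyclicPairs, cyclicPairs, consecutivePairs_append, consecutivePairs_append,
    h _ _ (by simp) (by simp), h _ _ (by simp) (by simp)]
  ext e
  simp only [Set.mem_union]
  tauto

theorem exists_append_of_mem_consecutivePairs {l : List α} {e : Sym2 α}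
    (he : e ∈ consecutivePairs l) : ∃ l₁ l₂ x y, l = l₁ ++ l₂ ∧ x ∈ l₁.getLast? ∧
      y ∈ l₂.head? ∧ e = s(x, y) := by
  induction l with
  | nil => exact he.elim
  | cons x t ih =>
    cases t with
    | nil => exact he.elim
    | cons y s =>
      rcases he with rfl | he
      · exact ⟨[x], y :: s, x, y, rfl, by simp, by simp, rfl⟩
      · obtain ⟨l₁, l₂, a, b, h, ha, hb, rfl⟩ := ih he
        refine ⟨x :: l₁, l₂, a, b, by simp [h], ?_, hb, rfl⟩
        cases l₁ with
        | nil => simp at ha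
        | cons c l₁ => simpa [List.getLast?_cons_cons] using ha

/-- A cyclic list can be cut open at any pair of cyclically consecutive entries. -/
theorem exists_perm_of_mem_cyclicPairs {l : List α} {a b : α} (h : s(a, b) ∈ cyclicPairs l) :
    ∃ l', l'.Perm l ∧ l'.head? = some a ∧ l'.getLast? = some b ∧
      cyclicPairs l = insert s(a, b) (consecutivePairs l') := by
  have key : ∀ {l' : List α} {x y : α}, l'.head? = some y → l'.getLast? = some x →
      cyclicPairs l' = insert s(x, y) (consecutivePairs l') := by
    intro l' x y hy hx
    ext e
    simp [cyclicPairs, jointPair, hx, hy]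
  have main : ∃ l' x y, l'.Perm l ∧ l'.head? = some y ∧ l'.getLast? = some x ∧
      cyclicPairs l = cyclicPairs l' ∧ s(a, b) = s(x, y) := by
    rcases h with h | ⟨x, hx, y, hy, h⟩
    · obtain ⟨l₁, l₂, x, y, rfl, hx, hy, h⟩ := exists_append_of_mem_consecutivePairs h
      have h₁ : l₁ ≠ [] := by rintro rfl; simp at hx
      have h₂ : l₂ ≠ [] := by rintro rfl; simp at hy
      exact ⟨l₂ ++ l₁, x, y, List.perm_append_comm,
        by rw [List.head?_append_of_ne_nil _ h₂]; exact hy,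
        by rw [List.getLast?_append_of_ne_nil _ h₁]; exact hx,
        cyclicPairs_append_comm _ _, h⟩
    · exact ⟨l, x, y, List.Perm.refl _, hy, hx, rfl, h⟩
  obtain ⟨l', x, y, hperm, hy, hx, hc, h⟩ := main
  rcases Sym2.eq_iff.mp h with ⟨rfl, rfl⟩ | ⟨rfl, rfl⟩
  · refine ⟨l'.reverse, (List.reverse_perm l').trans hperm, by simpa using hx, by simpa using hy, ?_⟩
    rw [hc, key hy hx, consecutivePairs_reverse]
  · refine ⟨l', hperm, hy, hx, ?_⟩
    rw [hc, key hy hx, Sym2.eq_swap]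

theorem mem_of_mem_cyclicPairs {l : List α} {e : Sym2 α} {x : α} (he : e ∈ cyclicPairs l)
    (hx : x ∈ e) : x ∈ l := by
  obtain ⟨y, rfl⟩ := hx
  obtain ⟨l', hperm, hx', -⟩ := exists_perm_of_mem_cyclicPairs he
  exact hperm.mem_iff.mp (List.mem_of_mem_head? hx')

theorem consecutivePairs_map {β : Type*} (f : α → β) (l : List α) :
    consecutivePairs (l.map f) = Sym2.map f '' consecutivePairs l := by
  induction l with
  | nil => simp [consecutivePairs]
  | cons x t ih =>
    cases t with
    | nil => simp [consecutivePairs]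
    | cons y s =>
      simp only [List.map_cons] at ih
      simp only [List.map_cons, consecutivePairs, ih, Set.image_insert_eq, Sym2.map_mk]

theorem cyclicPairs_map {β : Type*} (f : α → β) (l : List α) :
    cyclicPairs (l.map f) = Sym2.map f '' cyclicPairs l := by
  rw [cyclicPairs, cyclicPairs, Set.image_union, consecutivePairs_map]
  congr 1
  ext e
  simp only [jointPair, List.getLast?_map, List.head?_map, Set.mem_ofPred_eq, Set.mem_image,
    Option.mem_def, Option.map_eq_some_iff]
  constructor
  · rintro ⟨_, ⟨x, hx, rfl⟩, _, ⟨y, hy, rfl⟩, rfl⟩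
    exact ⟨_, ⟨x, hx, y, hy, rfl⟩, rfl⟩
  · rintro ⟨_, ⟨x, hx, y, hy, rfl⟩, rfl⟩
    exact ⟨_, ⟨x, hx, rfl⟩, _, ⟨y, hy, rfl⟩, rfl⟩

theorem consecutivePairs_map_range (f : ℕ → α) (n : ℕ) :
    consecutivePairs ((List.range (n + 1)).map f) = {e | ∃ k < n, e = s(f k, f (k + 1))} := by
  induction n with
  | zero => simp [List.range_succ, consecutivePairs]
  | succ n ih =>
    rw [List.range_succ, List.map_append, consecutivePairs_append, ih]
    ext e
    simp only [jointPair, List.range_succ, Set.mem_union, Set.mem_ofPred_eq, List.map_append,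
      List.map_cons, List.map_nil, consecutivePairs, Set.mem_empty_iff_false, or_false]
    simp only [List.getLast?_append, List.getLast?_singleton, Option.some_or, Option.mem_def,
      Option.some.injEq, exists_eq_left', List.head?_cons]
    constructor
    · rintro (⟨k, hk, rfl⟩ | rfl)
      · exact ⟨k, by omega, rfl⟩
      · exact ⟨n, by omega, rfl⟩
    · rintro ⟨k, hk, rfl⟩
      rcases Nat.lt_succ_iff_lt_or_eq.mp hk with h | rfl
      · exact Or.inl ⟨k, h, rfl⟩
      · exact Or.inr rfl

end Lists

/-! ### Surgery on cycles: detours, rungs and merging. -/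

namespace SimpleGraph

variable {α : Type*} {G : SimpleGraph α}

/-- `G` has a cycle whose set of vertices is `V` and whose set of edges contains `E`. -/
def HasCycleOn (G : SimpleGraph α) (V : Set α) (E : Set (Sym2 α)) : Prop :=
  ∃ l : List α, l.Nodup ∧ 3 ≤ l.length ∧ (∀ x, x ∈ l ↔ x ∈ V) ∧
    cyclicPairs l ⊆ G.edgeSet ∧ E ⊆ cyclicPairs l

theorem HasCycleOn.mono {V : Set α} {E E' : Set (Sym2 α)} (h : G.HasCycleOn V E)
    (hE : E' ⊆ E) : G.HasCycleOn V E' := by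
  obtain ⟨l, h₁, h₂, h₃, h₄, h₅⟩ := h
  exact ⟨l, h₁, h₂, h₃, h₄, hE.trans h₅⟩

theorem HasCycleOn.mem_of_mem {V : Set α} {E : Set (Sym2 α)} {e : Sym2 α} {x : α}
    (h : G.HasCycleOn V E) (he : e ∈ E) (hx : x ∈ e) : x ∈ V := by
  obtain ⟨l, -, -, h₃, -, h₅⟩ := h
  exact (h₃ x).mp (mem_of_mem_cyclicPairs (h₅ he) hx)

/-- An edge of a cycle may be replaced by a detour through a path disjoint from the cycle. -/
theorem HasCycleOn.detour {V : Set α} {E E' : Set (Sym2 α)} {a b c d : α} {l : List α}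
    (h : G.HasCycleOn V E) (hab : s(a, b) ∈ E) (hl : l.Nodup) (hdisj : ∀ x ∈ l, x ∉ V)
    (hc : l.head? = some c) (hd : l.getLast? = some d) (hedge : consecutivePairs l ⊆ G.edgeSet)
    (hbc : G.Adj b c) (hda : G.Adj d a)
    (hE : ∀ e ∈ E', (e ∈ E ∧ e ≠ s(a, b)) ∨ e ∈ consecutivePairs l) :
    G.HasCycleOn (V ∪ {x | x ∈ l}) E' := by
  obtain ⟨m, h₁, h₂, h₃, h₄, h₅⟩ := h
  obtain ⟨m', hperm, ha, hb, hcyc⟩ := exists_perm_of_mem_cyclicPairs (h₅ hab)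
  rw [hcyc] at h₄ h₅
  have hl0 : l ≠ [] := by rintro rfl; simp at hc
  have hm0 : m' ≠ [] := by rintro rfl; simp at ha
  refine ⟨m' ++ l, ?_, ?_, ?_, ?_, ?_⟩
  · rw [List.nodup_append]
    refine ⟨hperm.nodup_iff.mpr h₁, hl, ?_⟩
    rintro x hx y hy rfl
    exact hdisj x hy ((h₃ x).mp (hperm.mem_iff.mp hx))
  · rw [List.length_append, hperm.length_eq]
    omega
  · intro x
    simp [hperm.mem_iff, h₃]
  · rw [cyclicPairs, consecutivePairs_append]
    rintro e (((he | he) | ⟨x, hx, y, hy, rfl⟩) | ⟨x, hx, y, hy, rfl⟩)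
    · exact h₄ (Or.inr he)
    · exact hedge he
    · rw [hb] at hx; rw [hc] at hy
      cases hx; cases hy
      exact hbc
    · rw [List.getLast?_append_of_ne_nil _ hl0, hd] at hx
      rw [List.head?_append_of_ne_nil _ hm0, ha] at hy
      cases hx; cases hy
      exact hda
  · intro e he
    rw [cyclicPairs, consecutivePairs_append]
    rcases hE e he with ⟨he, hne⟩ | he
    · exact Or.inl (Or.inl (Or.inl ((h₅ he).resolve_left hne)))
    · exact Or.inl (Or.inl (Or.inr he))

/-- An edge `ab` of a cycle may be replaced by a path `auwb` through two new vertices. -/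
theorem HasCycleOn.insert {V V' : Set α} {E E' : Set (Sym2 α)} {a b u w : α}
    (h : G.HasCycleOn V E) (hab : s(a, b) ∈ E) (hu : u ∉ V) (hw : w ∉ V)
    (hau : G.Adj a u) (huw : G.Adj u w) (hwb : G.Adj w b)
    (hV : ∀ x, x ∈ V' ↔ x ∈ V ∨ x = u ∨ x = w)
    (hE : ∀ e ∈ E', (e ∈ E ∧ e ≠ s(a, b)) ∨ e = s(u, w)) :
    G.HasCycleOn V' E' := by
  have hV' : V' = V ∪ {x | x ∈ [w, u]} := by
    ext x
    simp [hV, or_comm]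
  rw [hV']
  refine h.detour hab (l := [w, u]) (c := w) (d := u) ?_ ?_ rfl rfl ?_ hwb.symm hau.symm ?_
  · simpa using huw.ne'
  · intro x hx
    rcases List.mem_pair.mp hx with rfl | rfl <;> assumption
  · simpa [consecutivePairs] using huw.symm
  · intro e he
    refine (hE e he).imp_right ?_
    rintro rfl
    exact Or.inl Sym2.eq_swap

/-- Two disjoint cycles with opposite sides `ab` and `cd` of a four-cycle can be merged. -/
theorem HasCycleOn.merge {V₁ V₂ V : Set α} {E₁ E₂ E : Set (Sym2 α)} {a b c d : α}
    (h₁ : G.HasCycleOn V₁ E₁) (h₂ : G.HasCycleOn V₂ E₂) (hdisj : ∀ x ∈ V₂, x ∉ V₁)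
    (hab : s(a, b) ∈ E₁) (hcd : s(c, d) ∈ E₂) (hac : G.Adj a c) (hbd : G.Adj b d)
    (hV : ∀ x, x ∈ V ↔ x ∈ V₁ ∨ x ∈ V₂)
    (hE : ∀ e ∈ E, (e ∈ E₁ ∧ e ≠ s(a, b)) ∨ (e ∈ E₂ ∧ e ≠ s(c, d))) :
    G.HasCycleOn V E := by
  obtain ⟨m, hm₁, -, hm₃, hm₄, hm₅⟩ := h₂
  rw [Sym2.eq_swap] at hcd
  obtain ⟨m', hperm, ha, hb, hcyc⟩ := exists_perm_of_mem_cyclicPairs (hm₅ hcd)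
  rw [hcyc] at hm₄ hm₅
  have hV' : V = V₁ ∪ {x | x ∈ m'} := by
    ext x
    simp [hV, hperm.mem_iff, hm₃]
  rw [hV']
  refine h₁.detour hab (hperm.nodup_iff.mpr hm₁) ?_ ha hb ?_ hbd hac.symm ?_
  · intro x hx
    exact hdisj x ((hm₃ x).mp (hperm.mem_iff.mp hx))
  · exact fun e he => hm₄ (Or.inr he)
  · intro e he
    refine (hE e he).imp_right fun h => (hm₅ h.1).resolve_left ?_
    rw [Sym2.eq_swap]
    exact h.2

theorem HasCycleOn.of_function {f : ℕ → α} {n : ℕ} {V : Set α} (hn : 3 ≤ n) (hf : f n = f 0)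
    (hinj : ∀ i < n, ∀ j < n, f i = f j → i = j) (hadj : ∀ i < n, G.Adj (f i) (f (i + 1)))
    (hV : ∀ x, x ∈ V ↔ ∃ i < n, f i = x) :
    G.HasCycleOn V {e | ∃ i < n, e = s(f i, f (i + 1))} := by
  obtain ⟨n, rfl⟩ : ∃ k, n = k + 1 := ⟨n - 1, by omega⟩
  have hcyc : cyclicPairs ((List.range (n + 1)).map f) =
      {e | ∃ i < n + 1, e = s(f i, f (i + 1))} := by
    rw [cyclicPairs, consecutivePairs_map_range]
    have hj : jointPair ((List.range (n + 1)).map f) ((List.range (n + 1)).map f) =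
        {s(f n, f (n + 1))} := by
      ext e
      simp [jointPair, hf, List.getLast?_range, List.head?_range]
    rw [hj]
    ext e
    simp only [Set.mem_union, Set.mem_ofPred_eq, Set.mem_singleton_iff]
    constructor
    · rintro (⟨k, hk, rfl⟩ | rfl)
      · exact ⟨k, by omega, rfl⟩
      · exact ⟨n, by omega, rfl⟩
    · rintro ⟨k, hk, rfl⟩
      rcases Nat.lt_succ_iff_lt_or_eq.mp hk with h | rfl
      · exact Or.inl ⟨k, h, rfl⟩
      · exact Or.inr rfl
  refine ⟨(List.range (n + 1)).map f, ?_, by simpa using hn, ?_, ?_, hcyc.ge⟩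
  · refine List.Nodup.map_on ?_ List.nodup_range
    intro x hx y hy
    exact hinj x (List.mem_range.mp hx) y (List.mem_range.mp hy)
  · intro x
    simp [hV]
  · rw [hcyc]
    rintro e ⟨i, hi, rfl⟩
    exact hadj i hi

theorem HasCycleOn.image {β : Type*} {H : SimpleGraph β} {V : Set α} {E : Set (Sym2 α)}
    (h : G.HasCycleOn V E) (f : α → β) (hf : Set.InjOn f V)
    (hadj : ∀ x ∈ V, ∀ y ∈ V, G.Adj x y → H.Adj (f x) (f y)) :
    H.HasCycleOn (f '' V) (Sym2.map f '' E) := by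
  obtain ⟨l, h₁, h₂, h₃, h₄, h₅⟩ := h
  refine ⟨l.map f, ?_, by simpa using h₂, ?_, ?_, ?_⟩
  · exact h₁.map_on fun x hx y hy => hf ((h₃ x).mp hx) ((h₃ y).mp hy)
  · intro y
    simp [h₃]
  · rw [cyclicPairs_map]
    rintro _ ⟨e, he, rfl⟩
    have hmem : ∀ x ∈ e, x ∈ V := fun x hx => (h₃ x).mp (mem_of_mem_cyclicPairs he hx)
    induction e with | h x y
    exact hadj x (hmem x (Sym2.mem_mk_left x y)) y (hmem y (Sym2.mem_mk_right x y)) (h₄ he)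
  · rw [cyclicPairs_map]
    exact Set.image_mono h₅

theorem HasCycleOn.isHamiltonian [Fintype α] [DecidableEq α] {E : Set (Sym2 α)}
    (h : G.HasCycleOn Set.univ E) : G.IsHamiltonian := by
  obtain ⟨l, h₁, h₂, h₃, h₄, -⟩ := h
  have hlen : l.length = Fintype.card α := by
    rw [← List.toFinset_card_of_nodup h₁, ← Finset.card_univ]
    congr 1
    ext x
    simp [h₃]
  intro _
  have hne : l ≠ [] := by rintro rfl; simp at h₂
  have hchain : ∀ m : List α, consecutivePairs m ⊆ G.edgeSet → m.IsChain G.Adj := by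
    intro m hm
    induction m with
    | nil => exact .nil
    | cons x t ih =>
      cases t with
      | nil => exact .singleton x
      | cons y s =>
        exact .cons_cons (hm (Or.inl rfl)) (ih fun e he => hm (Or.inr he))
  let p := Walk.ofSupport l hne (hchain l fun e he => h₄ (Or.inl he))
  have hp : p.support = l := Walk.support_ofSupport _ _
  have hplen : p.length = l.length - 1 := Walk.length_ofSupport _ _
  have hpath : p.IsPath := by rw [Walk.isPath_def, hp]; exact h₁
  have hclose : G.Adj (l.getLast hne) (l.head hne) :=
    h₄ (Or.inr ⟨_, List.getLast?_eq_some_getLast hne, _, List.head?_eq_some_head hne, rfl⟩)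
  refine ⟨_, Walk.cons hclose p, ?_⟩
  rw [Walk.isHamiltonianCycle_iff_isCycle_and_length_eq]
  refine ⟨?_, by rw [Walk.length_cons, hplen, ← hlen]; omega⟩
  rw [Walk.cons_isCycle_iff]
  refine ⟨hpath, fun hmem => ?_⟩
  -- A path containing the edge between its own ends has length one, whereas the list has at least
  -- three entries.
  rw [Sym2.eq_swap] at hmem
  have := hpath.length_eq_one_of_mem_edges hmem
  omega

end SimpleGraph

/-! ### The integer graph and the cycle on a layer. -/

/-- The graph on the integers joining two integers which differ by `p` or by `q`. -/
def integerProjectionGraph (p q : ℤ) : SimpleGraph ℤ where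
  Adj u v := u ≠ v ∧ (|u - v| = p ∨ |u - v| = q)
  symm := ⟨fun u v h => ⟨h.1.symm, by rw [abs_sub_comm v u]; exact h.2⟩⟩
  loopless := ⟨fun _ h => h.1 rfl⟩

theorem integerProjectionGraph_comm (p q : ℤ) :
    integerProjectionGraph p q = integerProjectionGraph q p := by
  ext u v
  simp only [integerProjectionGraph, or_comm]

theorem integerProjectionGraph_adj_of_sub_eq_left {p q u v : ℤ} (hp : 0 < p) (h : u - v = p) :
    (integerProjectionGraph p q).Adj u v :=
  ⟨fun huv => by omega, Or.inl (by rw [h, abs_of_pos hp])⟩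

theorem integerProjectionGraph_adj_of_sub_eq_right {p q u v : ℤ} (hq : 0 < q) (h : u - v = q) :
    (integerProjectionGraph p q).Adj u v :=
  ⟨fun huv => by omega, Or.inr (by rw [h, abs_of_pos hq])⟩

/-- The maximal elements, in their residue classes modulo `p + q`, of a set of integers. -/
def topLayer (p q : ℤ) (I : Set ℤ) : Set ℤ := {v | v ∈ I ∧ v + p + q ∉ I}

/-- The edges, of both kinds, between maximal elements of a set of integers. -/
def topLayerEdges (p q : ℤ) (I : Set ℤ) : Set (Sym2 ℤ) :=
  {e | ∃ v w, v ∈ topLayer p q I ∧ w ∈ topLayer p q I ∧ (w - v = p ∨ w - v = q) ∧ e = s(v, w)}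

theorem topLayerEdges_comm (p q : ℤ) (I : Set ℤ) : topLayerEdges p q I = topLayerEdges q p I := by
  have h : topLayer p q I = topLayer q p I := by
    ext v
    simp only [topLayer, Set.mem_ofPred_eq, add_right_comm]
  ext e
  simp only [topLayerEdges, h, or_comm]

section TopLayer

variable {p q : ℤ} {I : Set ℤ}

theorem sub_nsmul_mem (hIp : ∀ v ∈ I, v - p ∈ I) (hIq : ∀ v ∈ I, v - q ∈ I) {v : ℤ}
    (hv : v ∈ I) (n : ℕ) : v - n * (p + q) ∈ I := by
  induction n with
  | zero => simpa using hv
  | succ n ih =>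
    have := hIq _ (hIp _ ih)
    convert this using 1
    push_cast
    ring

/-- Each residue class has at most one maximal element: if `z ≥ 1`, descending from `w` by `z - 1`
multiples of `p + q` puts `v + p + q` in `I`. -/
theorem topLayer_eq_of_sub_eq_mul (hIp : ∀ v ∈ I, v - p ∈ I) (hIq : ∀ v ∈ I, v - q ∈ I)
    {v w : ℤ} (hv : v ∈ topLayer p q I) (hw : w ∈ topLayer p q I) {z : ℤ}
    (h : w - v = z * (p + q)) : w = v := by
  have key : ∀ {v w z : ℤ}, v ∈ topLayer p q I → w ∈ topLayer p q I → w - v = z * (p + q) →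
      z ≤ 0 := by
    intro v w z hv hw h
    by_contra! hz
    obtain ⟨n, hn⟩ := Int.eq_ofNat_of_zero_le (show 0 ≤ z - 1 by omega)
    apply hv.2
    have := sub_nsmul_mem hIp hIq hw.1 n
    rw [← hn] at this
    convert this using 1
    linarith
  have h₁ := key hv hw h
  have h₂ := key (z := -z) hw hv (by linarith)
  have : z = 0 := by omega
  subst this
  linarith

/-- The maximal elements of a set closed under subtraction of `p` and `q` form a cycle. -/
theorem hasCycleOn_topLayer (hp : 0 < p) (hq : 0 < q) (hpq : 3 ≤ p + q) (hcop : IsCoprime p q)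
    (hIp : ∀ v ∈ I, v - p ∈ I) (hIq : ∀ v ∈ I, v - q ∈ I) (hne : (topLayer p q I).Nonempty) :
    (integerProjectionGraph p q).HasCycleOn (topLayer p q I) (topLayerEdges p q I) := by
  classical
  obtain ⟨v₀, hv₀⟩ := hne
  obtain ⟨N, hN⟩ := Int.eq_ofNat_of_zero_le (show 0 ≤ p + q by omega)
  -- Both branches add `p` modulo `p + q`. If `v + p ∉ I`, then `v - q` is maximal precisely because
  -- `(v - q) + p + q = v + p`.
  set σ : ℤ → ℤ := fun v => if v + p ∈ I then v + p else v - q with hσ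
  have hσI : ∀ v ∈ topLayer p q I, σ v ∈ topLayer p q I := by
    intro v hv
    by_cases h : v + p ∈ I
    · simp only [hσ, if_pos h]
      refine ⟨h, fun h' => hv.2 ?_⟩
      have := hIp _ h'
      convert this using 1
      ring
    · simp only [hσ, if_neg h]
      refine ⟨hIq v hv.1, fun h' => h ?_⟩
      convert h' using 1
      ring
  have hσmod : ∀ v, ∃ z, σ v = v + p - z * (p + q) := by
    intro v
    by_cases h : v + p ∈ I
    · exact ⟨0, by simp only [hσ, if_pos h]; ring⟩
    · exact ⟨1, by simp only [hσ, if_neg h]; ring⟩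
  have hσadj : ∀ v, (integerProjectionGraph p q).Adj v (σ v) := by
    intro v
    by_cases h : v + p ∈ I
    · simp only [hσ, if_pos h]
      exact (integerProjectionGraph_adj_of_sub_eq_left hp (by ring)).symm
    · simp only [hσ, if_neg h]
      exact integerProjectionGraph_adj_of_sub_eq_right hq (by ring)
  set f : ℕ → ℤ := fun k => σ^[k] v₀ with hf
  have hfs : ∀ k, f (k + 1) = σ (f k) := fun k => Function.iterate_succ_apply' σ k v₀
  have hfI : ∀ k, f k ∈ topLayer p q I := by
    intro k
    induction k with
    | zero => exact hv₀
    | succ k ih => rw [hfs]; exact hσI _ ih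
  have hfmod : ∀ k : ℕ, ∃ z, f k = v₀ + k * p - z * (p + q) := by
    intro k
    induction k with
    | zero => exact ⟨0, by simp [hf]⟩
    | succ k ih =>
      obtain ⟨z, hz⟩ := ih
      obtain ⟨y, hy⟩ := hσmod (f k)
      exact ⟨z + y, by rw [hfs, hy, hz]; push_cast; ring⟩
  have hcopL : IsCoprime (p + q) p := by
    simpa [add_comm] using hcop.symm.add_mul_left_left 1
  have hsurj : ∀ x ∈ topLayer p q I, ∃ i < N, f i = x := by
    intro x hx
    -- `b` inverts `p` modulo `p + q`, so `x` is reached at time `(x - v₀) * b` reduced modulo `p +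
    -- q`.
    obtain ⟨a, b, hab⟩ := hcopL
    have hpos : 0 < p + q := by omega
    obtain ⟨i, hi⟩ := Int.eq_ofNat_of_zero_le (Int.emod_nonneg ((x - v₀) * b) hpos.ne')
    have hlt := Int.emod_lt_of_pos ((x - v₀) * b) hpos
    have hdiv := Int.mul_ediv_add_emod ((x - v₀) * b) (p + q)
    rw [hi] at hlt hdiv
    rw [hN] at hlt
    refine ⟨i, by exact_mod_cast hlt, ?_⟩
    obtain ⟨z, hz⟩ := hfmod i
    refine topLayer_eq_of_sub_eq_mul hIp hIq (z := -(x - v₀) * a - (x - v₀) * b / (p + q) * p - z)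
      hx (hfI i) ?_
    rw [hz]
    linear_combination p * hdiv + (x - v₀) * hab
  have hN3 : 3 ≤ N := by omega
  refine (SimpleGraph.HasCycleOn.of_function (f := f) (n := N) hN3 ?_ ?_ ?_ ?_).mono ?_
  · obtain ⟨z, hz⟩ := hfmod N
    refine topLayer_eq_of_sub_eq_mul hIp hIq (z := p - z) hv₀ (hfI N) ?_
    rw [hz, ← hN, show f 0 = v₀ from rfl]
    ring
  · intro i hi j hj hij
    obtain ⟨z, hz⟩ := hfmod i
    obtain ⟨y, hy⟩ := hfmod j
    have hdvd : p + q ∣ (i : ℤ) - j := by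
      refine hcopL.dvd_of_dvd_mul_right ⟨z - y, ?_⟩
      rw [hz, hy] at hij
      linear_combination hij
    have := Int.eq_zero_of_abs_lt_dvd hdvd (by rw [abs_lt]; constructor <;> omega)
    omega
  · intro i _
    rw [hfs]
    exact hσadj _
  · intro x
    refine ⟨hsurj x, ?_⟩
    rintro ⟨i, -, rfl⟩
    exact hfI i
  · rintro e ⟨v, w, hv, hw, h | h, rfl⟩
    · obtain ⟨i, hi, rfl⟩ := hsurj v hv
      refine ⟨i, hi, ?_⟩
      have : f i + p = w := by omega
      rw [hfs, hσ]
      simp only [this, if_pos hw.1]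
    -- An edge of length `q` is traversed downwards, from `w` to `v`: the upward step to `w + p = v
    -- + p + q` is blocked by the maximality of `v`.
    · obtain ⟨i, hi, rfl⟩ := hsurj w hw
      refine ⟨i, hi, ?_⟩
      have hnot : f i + p ∉ I := by
        intro h'
        apply hv.2
        convert h' using 1
        linarith
      rw [hfs, hσ]
      simp only [if_neg hnot]
      rw [Sym2.eq_swap, show f i - q = v by omega]

end TopLayer

/-! ### Corner sets: adding layers and even rows. -/

/-- `x` belongs to the numerical semigroup generated by `p` and `q`. -/
def IsCombination (p q x : ℤ) : Prop := ∃ a b : ℤ, 0 ≤ a ∧ 0 ≤ b ∧ x = a * p + b * q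

theorem isCombination_comm {p q x : ℤ} : IsCombination p q x ↔ IsCombination q p x := by
  constructor <;>
  · rintro ⟨a, b, ha, hb, rfl⟩
    exact ⟨b, a, hb, ha, by ring⟩

theorem IsCombination.add_left {p q x : ℤ} (h : IsCombination p q x) :
    IsCombination p q (x + p) := by
  obtain ⟨a, b, ha, hb, rfl⟩ := h
  exact ⟨a + 1, b, by omega, hb, by ring⟩

theorem IsCombination.add_right {p q x : ℤ} (h : IsCombination p q x) :
    IsCombination p q (x + q) := by
  obtain ⟨a, b, ha, hb, rfl⟩ := h
  exact ⟨a, b + 1, ha, by omega, by ring⟩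

/-- Coefficient pairs of one number differ by multiples of `(q, -p)`; making the coefficient `-1` of
`q` nonnegative costs at least `q` copies of `p`, more than `k` allows. -/
theorem not_isCombination_mul_sub {p q k : ℤ} (hp : 0 < p) (hq : 0 < q) (hcop : IsCoprime p q)
    (hk : k < q) : ¬ IsCombination p q (k * p - q) := by
  rintro ⟨a, b, ha, hb, h⟩
  have h₁ : (k - a) * p = (b + 1) * q := by linear_combination h
  have hdvd : q ∣ k - a := hcop.symm.dvd_of_dvd_mul_right ⟨b + 1, by rw [h₁]; ring⟩
  have hpos : 0 < k - a := by
    by_contra! hneg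
    nlinarith [mul_pos (show 0 < b + 1 by omega) hq]
  have := Int.le_of_dvd hpos hdvd
  omega

/-- The integers below `m`, together with all `C - x` with `x` in the semigroup generated by
`p` and `q`. -/
def cornerSet (p q m C : ℤ) : Set ℤ := {v | v < m ∨ IsCombination p q (C - v)}

/-- Alternate edges in the run of steps of length `p` which ends at the corner `C`. -/
def rowEdges (p q m C : ℤ) : Set (Sym2 ℤ) :=
  {e | ∃ k, 0 ≤ k ∧ 2 * k + 1 < q ∧ m ≤ C + q - (2 * k + 1) * p ∧
    e = s(C - 2 * k * p, C - (2 * k + 1) * p)}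

/-- The nonnegative part of `cornerSet p q m C` has a Hamiltonian cycle which traverses alternate
edges of both runs at the corner. -/
def HasCornerCycle (p q m C : ℤ) : Prop :=
  (integerProjectionGraph p q).HasCycleOn {v | 0 ≤ v ∧ v ∈ cornerSet p q m C}
    (rowEdges p q m C ∪ rowEdges q p m C)

theorem cornerSet_comm (p q m C : ℤ) : cornerSet p q m C = cornerSet q p m C := by
  ext v
  simp only [cornerSet, Set.mem_ofPred_eq, isCombination_comm (p := p)]

theorem HasCornerCycle.swap {p q m C : ℤ} (h : HasCornerCycle p q m C) :
    HasCornerCycle q p m C := by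
  rw [HasCornerCycle, integerProjectionGraph_comm, cornerSet_comm, Set.union_comm]
  exact h

section CornerSet

variable {p q m C : ℤ}

theorem sub_left_mem_cornerSet (hp : 0 < p) {v : ℤ} (hv : v ∈ cornerSet p q m C) :
    v - p ∈ cornerSet p q m C := by
  rcases hv with hv | hv
  · exact Or.inl (by omega)
  · refine Or.inr ?_
    have := hv.add_left
    rwa [show C - v + p = C - (v - p) by ring] at this

theorem sub_right_mem_cornerSet (hq : 0 < q) {v : ℤ} (hv : v ∈ cornerSet p q m C) :
    v - q ∈ cornerSet p q m C := by
  rw [cornerSet_comm] at hv ⊢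
  exact sub_left_mem_cornerSet hq hv

theorem sub_mul_mem_cornerSet {k : ℤ} (hk : 0 ≤ k) : C - k * p ∈ cornerSet p q m C :=
  Or.inr ⟨k, 0, hk, le_rfl, by ring⟩

theorem add_sub_mul_notMem_cornerSet (hp : 0 < p) (hq : 0 < q) (hcop : IsCoprime p q) {k : ℤ}
    (hk : k < q) (hm : m ≤ C + q - k * p) : C + q - k * p ∉ cornerSet p q m C := by
  rintro (h | h)
  · omega
  · rw [show C - (C + q - k * p) = k * p - q by ring] at h
    exact not_isCombination_mul_sub hp hq hcop hk h

/-- The bounds in `rowEdges` place the translates of both endpoints by `p + q` outside the set, so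
the endpoints are maximal and the layer cycle must use the edge between them. -/
theorem rowEdges_subset (hp : 0 < p) (hq : 0 < q) (hcop : IsCoprime p q) :
    rowEdges p q m C ⊆ topLayerEdges p q (cornerSet p q m C) := by
  rintro e ⟨k, hk, hkq, hm, rfl⟩
  refine ⟨C - (2 * k + 1) * p, C - 2 * k * p, ⟨sub_mul_mem_cornerSet (by omega), ?_⟩,
    ⟨sub_mul_mem_cornerSet (by omega), ?_⟩, Or.inl (by ring), Sym2.eq_swap⟩
  · rw [show C - (2 * k + 1) * p + p + q = C + q - 2 * k * p by ring]
    exact add_sub_mul_notMem_cornerSet hp hq hcop (by omega) (by linarith)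
  · rw [show C - 2 * k * p + p + q = C + q - (2 * k - 1) * p by ring]
    exact add_sub_mul_notMem_cornerSet hp hq hcop (by omega) (by linarith)

theorem rowEdges_union_subset (hp : 0 < p) (hq : 0 < q) (hcop : IsCoprime p q) :
    rowEdges p q m C ∪ rowEdges q p m C ⊆ topLayerEdges p q (cornerSet p q m C) := by
  refine Set.union_subset (rowEdges_subset hp hq hcop) ?_
  rw [topLayerEdges_comm, cornerSet_comm]
  exact rowEdges_subset hq hp hcop.symm

/-- Hence moving `m` and `C` up by `p + q` adds exactly the top layer of the new set. -/
theorem add_mem_cornerSet_iff (v : ℤ) :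
    v + p + q ∈ cornerSet p q (m + (p + q)) (C + (p + q)) ↔ v ∈ cornerSet p q m C := by
  simp only [cornerSet, Set.mem_ofPred_eq]
  rw [show C + (p + q) - (v + p + q) = C - v by ring]
  exact or_congr_left (by omega)

/-- Merging a layer consumes the second edge of the `p`-run at the new corner. Its parity keeps it
out of the alternate edges, which therefore all survive. -/
theorem ne_of_mem_rowEdges_union (hp : 0 < p) (hq : 0 < q) {e : Sym2 ℤ}
    (he : e ∈ rowEdges p q m C ∪ rowEdges q p m C) : e ≠ s(C - p, C - 2 * p) := by
  rintro rfl
  rcases he with ⟨k, hk, -, -, h⟩ | ⟨k, hk, -, -, h⟩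
  · rcases Sym2.eq_iff.mp h with ⟨h₁, h₂⟩ | ⟨h₁, h₂⟩
    · have : 2 * k = 1 := mul_right_cancel₀ hp.ne' (by linarith)
      omega
    · have : 2 * k = 0 := mul_right_cancel₀ hp.ne' (by linarith)
      have : 2 * k = 2 := mul_right_cancel₀ hp.ne' (by linarith)
      omega
  · rcases Sym2.eq_iff.mp h with ⟨h₁, h₂⟩ | ⟨h₁, h₂⟩
    · have : 2 * k = 1 := mul_right_cancel₀ hq.ne' (by linarith)
      omega
    · have : 2 * k = -2 := mul_right_cancel₀ hq.ne' (by linarith)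
      omega

/-- The cycle formed by the top layer of a corner set with `m = p + q` and a corner below `m`. -/
theorem HasCornerCycle.initial (hp : 0 < p) (hq : 0 < q) (hpq : 3 ≤ p + q)
    (hcop : IsCoprime p q) (hC : C < p + q) : HasCornerCycle p q (p + q) C := by
  have hI : ∀ v, v ∈ cornerSet p q (p + q) C ↔ v < p + q := by
    intro v
    refine ⟨?_, Or.inl⟩
    rintro (h | ⟨a, b, ha, hb, h⟩)
    · exact h
    · nlinarith [mul_nonneg ha hp.le, mul_nonneg hb hq.le]
  have htop : {v | 0 ≤ v ∧ v ∈ cornerSet p q (p + q) C} =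
      topLayer p q (cornerSet p q (p + q) C) := by
    ext v
    simp only [topLayer, Set.mem_ofPred_eq, hI]
    omega
  rw [HasCornerCycle, htop]
  refine (hasCycleOn_topLayer hp hq hpq hcop (fun v => sub_left_mem_cornerSet hp)
    (fun v => sub_right_mem_cornerSet hq) ?_).mono (rowEdges_union_subset hp hq hcop)
  rw [← htop]
  exact ⟨0, le_rfl, (hI 0).mpr (by omega)⟩

/-- A cycle through the edge at the corner can be merged with the next layer. -/
theorem HasCornerCycle.of_hasCycleOn (hp : 0 < p) (hq : 0 < q) (hpq : 3 ≤ p + q)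
    (hcop : IsCoprime p q) (hm : 0 ≤ m) (hmC : m ≤ C - p + q) (hq1 : 1 < q)
    (h : (integerProjectionGraph p q).HasCycleOn {v | 0 ≤ v ∧ v ∈ cornerSet p q m C}
      {s(C, C - p)}) :
    HasCornerCycle p q (m + (p + q)) (C + (p + q)) := by
  set I := cornerSet p q m C with hI
  set I' := cornerSet p q (m + (p + q)) (C + (p + q)) with hI'
  have hshift : ∀ v, v + p + q ∈ I' ↔ v ∈ I := add_mem_cornerSet_iff
  have hIp : ∀ v ∈ I', v - p ∈ I' := fun v => sub_left_mem_cornerSet hp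
  have hIq : ∀ v ∈ I', v - q ∈ I' := fun v => sub_right_mem_cornerSet hq
  have htop : ∀ v, v ∈ topLayer p q I' ↔ v ∈ I' ∧ v ∉ I := by
    intro v
    simp only [topLayer, Set.mem_ofPred_eq, hshift]
  have hsub : ∀ v ∈ I, v ∈ I' := by
    intro v hv
    have := hIq _ (hIp _ ((hshift v).mpr hv))
    convert this using 1
    ring
  have hc : C + q ∈ topLayer p q I' := by
    rw [htop]
    constructor
    · convert sub_mul_mem_cornerSet (p := p) (q := q) (m := m + (p + q)) (C := C + (p + q))
        (k := 1) (by omega) using 1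
      ring
    · have := add_sub_mul_notMem_cornerSet (m := m) (C := C) hp hq hcop (k := 0) (by omega)
        (by linarith)
      simpa using this
  have hd : C - p + q ∈ topLayer p q I' := by
    rw [htop]
    constructor
    · convert sub_mul_mem_cornerSet (p := p) (q := q) (m := m + (p + q)) (C := C + (p + q))
        (k := 2) (by omega) using 1
      ring
    · have := add_sub_mul_notMem_cornerSet (m := m) (C := C) hp hq hcop (k := 1) (by omega)
        (by linarith)
      rwa [show C + q - 1 * p = C - p + q by ring] at this
  refine h.merge (hasCycleOn_topLayer hp hq hpq hcop hIp hIq ⟨_, hc⟩) (a := C) (b := C - p)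
    (c := C + q) (d := C - p + q) ?_ rfl ⟨_, _, hd, hc, Or.inl (by ring), Sym2.eq_swap⟩
    (integerProjectionGraph_adj_of_sub_eq_right hq (by ring)).symm
    (integerProjectionGraph_adj_of_sub_eq_right hq (by ring)).symm ?_ ?_
  · intro x hx hx'
    exact ((htop x).mp hx).2 hx'.2
  · intro x
    simp only [Set.mem_ofPred_eq, htop]
    constructor
    · rintro ⟨h0, hx⟩
      by_cases hxI : x ∈ I
      · exact Or.inl ⟨h0, hxI⟩
      · exact Or.inr ⟨hx, hxI⟩
    · rintro (⟨h0, hx⟩ | ⟨hx, hxI⟩)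
      · exact ⟨h0, hsub x hx⟩
      · refine ⟨?_, hx⟩
        by_contra! hneg
        exact hxI (Or.inl (by omega))
  · intro e he
    refine Or.inr ⟨rowEdges_union_subset hp hq hcop he, ?_⟩
    convert ne_of_mem_rowEdges_union hp hq he using 3 <;> ring

/-- A row of `2 * r` vertices can be added on top of `r` disjoint edges of a cycle. -/
theorem SimpleGraph.HasCycleOn.insert_row (hp : 0 < p) (hq : 0 < q) {V : Set ℤ} (r : ℕ)
    (hnew : ∀ j, 0 ≤ j → j < 2 * (r : ℤ) → C + q - j * p ∉ V)
    (h : (integerProjectionGraph p q).HasCycleOn V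
      {e | ∃ k, 0 ≤ k ∧ k < (r : ℤ) ∧ e = s(C - 2 * k * p, C - (2 * k + 1) * p)}) :
    (integerProjectionGraph p q).HasCycleOn
      (V ∪ {v | ∃ j, 0 ≤ j ∧ j < 2 * (r : ℤ) ∧ v = C + q - j * p})
      {e | ∃ k, 0 ≤ k ∧ k < (r : ℤ) ∧ e = s(C + q - 2 * k * p, C + q - (2 * k + 1) * p)} := by
  have hinj : ∀ {x i j : ℤ}, x - i * p = x - j * p → i = j := fun h =>
    mul_right_cancel₀ hp.ne' (by linarith)
  -- After `n` rungs, the base edges from index `n` on are still free and the first `n` lifted edges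
  -- are already present.
  have key : ∀ n : ℕ, n ≤ r → (integerProjectionGraph p q).HasCycleOn
      (V ∪ {v | ∃ j, 0 ≤ j ∧ j < 2 * (n : ℤ) ∧ v = C + q - j * p})
      ({e | ∃ k, (n : ℤ) ≤ k ∧ k < (r : ℤ) ∧ e = s(C - 2 * k * p, C - (2 * k + 1) * p)} ∪
        {e | ∃ k, 0 ≤ k ∧ k < (n : ℤ) ∧
          e = s(C + q - 2 * k * p, C + q - (2 * k + 1) * p)}) := by
    intro n
    induction n with
    | zero =>
      intro _
      convert h using 1
      · ext v
        simp only [Set.mem_union, Set.mem_ofPred_eq, or_iff_left_iff_imp, Nat.cast_zero]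
        rintro ⟨j, h₁, h₂, -⟩
        omega
      · ext e
        simp only [Set.mem_union, Set.mem_ofPred_eq, Nat.cast_zero]
        refine or_iff_left ?_
        rintro ⟨k, h₁, h₂, -⟩
        omega
    | succ n ih =>
      intro hn
      have hnotin : ∀ j, 2 * (n : ℤ) ≤ j → j ≤ 2 * n + 1 →
          C + q - j * p ∉ V ∪ {v | ∃ j, 0 ≤ j ∧ j < 2 * (n : ℤ) ∧ v = C + q - j * p} := by
        rintro j h₁ h₂ (hj | ⟨i, hi, hi', hij⟩)
        · exact hnew j (by omega) (by omega) hj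
        · have := hinj hij
          omega
      refine (ih (by omega)).insert (a := C - 2 * n * p) (b := C - (2 * n + 1) * p)
        (u := C + q - 2 * n * p) (w := C + q - (2 * n + 1) * p)
        (Or.inl ⟨n, le_rfl, by omega, rfl⟩) (hnotin _ le_rfl (by omega))
        (hnotin _ (by omega) le_rfl)
        (integerProjectionGraph_adj_of_sub_eq_right hq (by ring)).symm
        (integerProjectionGraph_adj_of_sub_eq_left hp (by ring))
        (integerProjectionGraph_adj_of_sub_eq_right hq (by ring)) ?_ ?_
      · intro x
        simp only [Set.mem_union, Set.mem_ofPred_eq, or_assoc]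
        refine or_congr_right ?_
        push_cast
        constructor
        · rintro ⟨j, h₁, h₂, rfl⟩
          rcases lt_or_ge j (2 * n) with h | h
          · exact Or.inl ⟨j, h₁, h, rfl⟩
          · obtain rfl | rfl : j = 2 * n ∨ j = 2 * n + 1 := by omega
            · exact Or.inr (Or.inl rfl)
            · exact Or.inr (Or.inr rfl)
        · rintro (⟨j, h₁, h₂, rfl⟩ | rfl | rfl)
          · exact ⟨j, h₁, by omega, rfl⟩
          · exact ⟨2 * n, by omega, by omega, rfl⟩
          · exact ⟨2 * n + 1, by omega, by omega, rfl⟩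
      · push_cast
        rintro e (⟨k, h₁, h₂, rfl⟩ | ⟨k, h₁, h₂, rfl⟩)
        · refine Or.inl ⟨Or.inl ⟨k, by omega, h₂, rfl⟩, fun h => ?_⟩
          rcases Sym2.eq_iff.mp h with ⟨h, -⟩ | ⟨h, -⟩
          · have := hinj h
            omega
          · have := hinj h
            omega
        · rcases lt_or_ge k n with hkn | hkn
          · refine Or.inl ⟨Or.inr ⟨k, h₁, hkn, rfl⟩, fun h' => ?_⟩
            apply hnew (2 * k) (by omega) (by omega)
            rcases Sym2.eq_iff.mp h' with ⟨h', -⟩ | ⟨h', -⟩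
            · rw [h']
              exact h.mem_of_mem ⟨n, by omega, by omega, rfl⟩ (Sym2.mem_mk_left _ _)
            · rw [h']
              exact h.mem_of_mem ⟨n, by omega, by omega, rfl⟩ (Sym2.mem_mk_right _ _)
          · obtain rfl : k = n := by omega
            exact Or.inr rfl
  refine (key r le_rfl).mono ?_
  exact Set.subset_union_right

/-- Adding a row with an even number of vertices, followed by a layer. -/
theorem HasCornerCycle.row_step (hp : 0 < p) (hq : 0 < q) (hcop : IsCoprime p q) (hm : p + q ≤ m)
    (h : HasCornerCycle p q m C) (r : ℕ) (hr : 1 ≤ r) (hrq : 2 * (r : ℤ) ≤ q)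
    (hlow : (2 * (r : ℤ) - 1) * p ≤ C - m + q) (hupp : C - m + q < 2 * (r : ℤ) * p) :
    HasCornerCycle p q (m + (p + q)) (C + q + (p + q)) := by
  have hcell : ∀ j, j < 2 * (r : ℤ) → m ≤ C + q - j * p := by
    intro j hj
    nlinarith
  -- Laying the row uses up the old alternate edges; the next layer supplies fresh ones for both
  -- runs.
  refine HasCornerCycle.of_hasCycleOn hp hq (by omega) hcop (by omega) ?_ (by omega) ?_
  · have := hcell 1 (by omega)
    linarith
  have hins := SimpleGraph.HasCycleOn.insert_row (C := C) hp hq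
    (V := {v | 0 ≤ v ∧ v ∈ cornerSet p q m C}) r ?_ (h.mono ?_)
  · convert hins.mono (E' := {s(C + q, C + q - p)}) ?_ using 1
    · ext v
      simp only [Set.mem_union, Set.mem_ofPred_eq, cornerSet]
      constructor
      · rintro ⟨h0, hv | ⟨a, b, ha, hb, hv⟩⟩
        · exact Or.inl ⟨h0, Or.inl hv⟩
        · by_cases hvm : v < m
          · exact Or.inl ⟨h0, Or.inl hvm⟩
          -- Coefficient `b = 0` means the new row, where `hupp` forces `a < 2 * r`; with `b ≥ 1`
          -- the point was already present.
          rcases eq_or_lt_of_le hb with rfl | hb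
          · refine Or.inr ⟨a, ha, ?_, by linarith⟩
            by_contra! har
            nlinarith
          · exact Or.inl ⟨h0, Or.inr ⟨a, b - 1, ha, by omega, by linarith⟩⟩
      · rintro (⟨h0, hv | hv⟩ | ⟨j, hj, hj', rfl⟩)
        · exact ⟨h0, Or.inl hv⟩
        · refine ⟨h0, Or.inr ?_⟩
          rw [add_sub_right_comm]
          exact hv.add_right
        · have := hcell j hj'
          exact ⟨by omega, Or.inr ⟨j, 0, hj, le_rfl, by ring⟩⟩
    · rintro _ rfl
      exact ⟨0, le_rfl, by omega, by simp⟩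
  · intro j hj hj' hv
    exact add_sub_mul_notMem_cornerSet hp hq hcop (by omega) (hcell j hj') hv.2
  · rintro e ⟨k, hk, hkr, rfl⟩
    exact Or.inl ⟨k, hk, by omega, hcell _ (by omega), rfl⟩

end CornerSet

/-! ### Growing the corner past the Frobenius number. -/

section Growth

variable {p q h : ℤ}

/-- The corner cycle obtained by alternately adding one row and all columns for which the
number of new vertices is even. -/
theorem hasCornerCycle_growth (hp : 0 < p) (hpq : p < q) (hcop : IsCoprime p q)
    (hh : q - p + 1 = 2 * h) (J : ℕ → ℤ) (hJ : ∀ t : ℕ, J t = (t * q + h - 1) / p) (t : ℕ) :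
    2 * (t : ℤ) ≤ p → HasCornerCycle p q ((1 + t + (J t - J 0)) * (p + q))
      ((1 + t + (J t - J 0)) * (p + q) + (-h + t * q + J t * p)) := by
  have hq : 0 < q := by omega
  have hle : ∀ t : ℕ, J t * p ≤ t * q + h - 1 := fun t => by
    rw [hJ]; exact Int.ediv_mul_le _ hp.ne'
  have hlt : ∀ t : ℕ, t * q + h - 1 < (J t + 1) * p := fun t => by
    rw [hJ]; exact Int.lt_ediv_add_one_mul_self _ hp
  have hJ0 : ∀ t : ℕ, J 0 ≤ J t := fun t => by
    rw [hJ, hJ]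
    refine Int.ediv_le_ediv hp ?_
    have : (0 : ℤ) ≤ t * q := by positivity
    push_cast
    linarith
  induction t with
  | zero =>
    intro _
    -- At `t = 0`, `C - m = -h + J 0 * p ≤ -1`: the corner still lies below `m`.
    convert HasCornerCycle.initial (p := p) (q := q) (C := p + q + (-h + J 0 * p)) hp hq
      (by omega) hcop ?_ using 1
    · push_cast; ring
    · push_cast; ring
    · have := hle 0
      push_cast at this
      linarith
  | succ t ih =>
    intro ht
    push_cast at ht
    -- One row first, then columns one at a time. Since `q - h = p + h - 1`, the row has exactly `2
    -- * (J t + 1)` new vertices if and only if `J t` is the floor of `(t * q + h - 1) / p`. The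
    -- column number `j + 1` has exactly `2 * (t + 1)` if and only if `t * q + h ≤ (j + 1) * p < (t
    -- + 1) * q + h`, that is `J t < j + 1 ≤ J (t + 1)`.
    have hrow : ∀ i : ℕ, J t + i ≤ J (t + 1) →
        HasCornerCycle p q ((2 + t + (J t + i - J 0)) * (p + q))
          ((2 + t + (J t + i - J 0)) * (p + q) + (-h + (t + 1) * q + (J t + i) * p)) := by
      intro i
      induction i with
      | zero =>
        intro _
        have hr : ((J t + 1).toNat : ℤ) = J t + 1 := by
          refine Int.toNat_of_nonneg ?_
          by_contra! hneg
          have := hlt t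
          have : (0 : ℤ) ≤ t * q := by positivity
          nlinarith
        have hJpos : 0 < J t + 1 := by
          by_contra! hneg
          have := hlt t
          have : (0 : ℤ) ≤ t * q := by positivity
          nlinarith
        have h₁ := hle t
        have h₂ := hlt t
        convert (ih (by omega)).row_step hp hq hcop ?_ (J t + 1).toNat (by omega) ?_ ?_ ?_ using 1
        · push_cast; ring
        · push_cast; ring
        · have := hJ0 t
          nlinarith [mul_nonneg (show (0 : ℤ) ≤ t + (J t - J 0) by omega)
            (show (0 : ℤ) ≤ p + q by omega)]
        · rw [hr]
          have h₃ : 2 * J t < q - 1 := by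
            refine lt_of_mul_lt_mul_right (a := p) ?_ hp.le
            nlinarith
          omega
        · rw [hr]
          linarith
        · rw [hr]
          linarith
      | succ i ihi =>
        intro hi
        push_cast at hi
        have h₁ : (J t + i + 1) * p ≤ (t + 1) * q + h - 1 := by
          have := hle (t + 1)
          push_cast at this
          nlinarith
        have h₂ : t * q + h ≤ (J t + i + 1) * p := by
          have := hlt t
          have : (0 : ℤ) ≤ i * p := by positivity
          linarith
        convert ((ihi (by omega)).swap.row_step hq hp hcop.symm ?_ (t + 1) (by omega) ?_ ?_
          ?_).swap using 1
        · push_cast; ring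
        · push_cast; ring
        · have := hJ0 t
          nlinarith [mul_nonneg (show (0 : ℤ) ≤ 1 + t + (J t + i - J 0) by omega)
            (show (0 : ℤ) ≤ p + q by omega)]
        · push_cast
          exact ht
        · push_cast
          linarith
        · push_cast
          linarith
    have hmono : J t ≤ J (t + 1) := by
      rw [hJ, hJ]
      refine Int.ediv_le_ediv hp ?_
      push_cast
      linarith
    have := hrow (J (t + 1) - J t).toNat (by omega)
    rw [Int.toNat_of_nonneg (by omega)] at this
    convert this using 1
    · push_cast; ring
    · push_cast; ring

/-- Some corner set beyond the Frobenius number has a suitable Hamiltonian cycle. -/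
theorem exists_hasCornerCycle (hp : 0 < p) (hpq : p < q) (hcop : IsCoprime p q)
    (hodd : Odd (p + q)) :
    ∃ K c : ℤ, 0 ≤ K ∧ 2 * K ≤ p + q + 1 ∧ p * q - p - q ≤ c ∧ c ≤ p * q - 1 ∧
      HasCornerCycle p q (K * (p + q)) (K * (p + q) + c) := by
  have hq : 0 < q := by omega
  obtain ⟨h, hh⟩ : ∃ h, q - p + 1 = 2 * h := ⟨(q - p + 1) / 2, by obtain ⟨k, hk⟩ := hodd; omega⟩
  -- With `t = ⌊(p - 1) / 2⌋`, one more row gives a `c` between `(2 * t + 1) * q - p` and `(2 * t +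
  -- 1) * q - 1`, where `2 * t + 1` is `p - 1` or `p`.
  obtain ⟨t, ht⟩ := Int.eq_ofNat_of_zero_le (show 0 ≤ (p - 1) / 2 by omega)
  have ht₁ : 2 * (t : ℤ) ≤ p - 1 := by omega
  have ht₂ : p ≤ 2 * t + 2 := by omega
  have hgrow := hasCornerCycle_growth hp hpq hcop hh (fun t => (t * q + h - 1) / p)
    (fun _ => rfl) t (by omega)
  have h₁ : (t * q + h - 1) / p * p ≤ t * q + h - 1 := Int.ediv_mul_le _ hp.ne'
  have h₂ : t * q + h - 1 < ((t * q + h - 1) / p + 1) * p := Int.lt_ediv_add_one_mul_self _ hp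
  have h₀ : 0 ≤ (h - 1) / p := Int.ediv_nonneg (by omega) hp.le
  have h₃ : (h - 1) / p ≤ (t * q + h - 1) / p := by
    refine Int.ediv_le_ediv hp ?_
    have : (0 : ℤ) ≤ t * q := by positivity
    linarith
  simp only [Nat.cast_zero, zero_mul, zero_add] at hgrow
  set j := (t * q + h - 1) / p
  set j₀ := (h - 1) / p
  have hjq : 2 * j + 2 ≤ q := by
    have : 2 * j < q - 1 := by
      refine lt_of_mul_lt_mul_right (a := p) ?_ hp.le
      nlinarith
    omega
  have hr : ((j + 1).toNat : ℤ) = j + 1 := Int.toNat_of_nonneg (by omega)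
  refine ⟨2 + t + (j - j₀), -h + (t + 1) * q + j * p, by omega, by omega, by nlinarith,
    by nlinarith, ?_⟩
  convert hgrow.row_step hp hq hcop ?_ (j + 1).toNat (by omega) ?_ ?_ ?_ using 1
  · ring
  · ring
  · nlinarith [mul_nonneg (show (0 : ℤ) ≤ t + (j - j₀) by omega) (show (0 : ℤ) ≤ p + q by omega)]
  · rw [hr]
    linarith
  · rw [hr]
    linarith
  · rw [hr]
    linarith

end Growth

/-! ### Symmetry of the semigroup about its Frobenius number. -/

section Semigroup

variable {p q : ℤ}

/-- Write `x = a * p + b * q` with `0 ≤ a < q`. If `b < 0`, then `F - x = (q - 1 - a) * p + (-1 - b)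
* q` has nonnegative coefficients. -/
theorem isCombination_or_isCombination_sub (hq : 0 < q) (hcop : IsCoprime p q)
    (x : ℤ) : IsCombination p q x ∨ IsCombination p q (p * q - p - q - x) := by
  obtain ⟨u, v, huv⟩ := hcop
  have h₁ := Int.emod_nonneg (x * u) hq.ne'
  have h₂ := Int.emod_lt_of_pos (x * u) hq
  have h₃ := Int.mul_ediv_add_emod (x * u) q
  set a := x * u % q
  set d := x * u / q
  have hx : x = a * p + (x * v + d * p) * q := by linear_combination -x * huv - p * h₃
  rcases le_or_gt 0 (x * v + d * p) with hb | hb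
  · exact Or.inl ⟨a, _, h₁, hb, hx⟩
  · exact Or.inr ⟨q - 1 - a, -1 - (x * v + d * p), by omega, by omega, by linear_combination -hx⟩

theorem IsCombination.not_sub (hp : 0 < p) (hq : 0 < q) (hcop : IsCoprime p q) {x : ℤ}
    (h : IsCombination p q x) : ¬ IsCombination p q (p * q - p - q - x) := by
  obtain ⟨a, b, ha, hb, rfl⟩ := h
  rintro ⟨c, d, hc, hd, h⟩
  refine not_isCombination_mul_sub (k := q - 1 - a - c) hp hq hcop (by omega)
    ⟨0, b + d, le_rfl, by omega, ?_⟩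
  linear_combination h

theorem IsCombination.nonneg (hp : 0 < p) (hq : 0 < q) {x : ℤ} (h : IsCombination p q x) :
    0 ≤ x := by
  obtain ⟨a, b, ha, hb, rfl⟩ := h
  positivity

theorem isCombination_of_lt (hp : 0 < p) (hq : 0 < q) (hcop : IsCoprime p q) {x : ℤ}
    (hx : p * q - p - q < x) : IsCombination p q x := by
  refine (isCombination_or_isCombination_sub hq hcop x).resolve_right fun h => ?_
  have := h.nonneg hp hq
  omega

end Semigroup

/-! ### Full corners: free movement and gluing. -/

/-- The nonnegative integers `v` with `C - v` in the semigroup generated by `f` and `2 * r` have a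
Hamiltonian cycle which traverses alternate edges of the run of length `2 * r` at `C`. -/
def HasFullCornerCycle (f : ℤ) (r : ℕ) (C : ℤ) : Prop :=
  (integerProjectionGraph f (2 * r)).HasCycleOn {v | 0 ≤ v ∧ IsCombination f (2 * r) (C - v)}
    {e | ∃ k, 0 ≤ k ∧ k < (r : ℤ) ∧ e = s(C - 2 * k * f, C - (2 * k + 1) * f)}

/-- A stack of parallel edges can be added on top of an edge of a cycle. -/
theorem SimpleGraph.HasCycleOn.insert_stack {p q : ℤ} (hp : 0 < p) (hq : 0 < q)
    (hdvd : ¬ q ∣ p) {V : Set ℤ} {E : Set (Sym2 ℤ)} {x y : ℤ} (hxy : x - y = p) (n : ℕ)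
    (hx : ∀ j, 1 ≤ j → j ≤ (n : ℤ) → x + j * q ∉ V)
    (hy : ∀ j, 1 ≤ j → j ≤ (n : ℤ) → y + j * q ∉ V)
    (h : (integerProjectionGraph p q).HasCycleOn V E) (he : s(x, y) ∈ E) :
    (integerProjectionGraph p q).HasCycleOn
      (V ∪ {v | ∃ j, 1 ≤ j ∧ j ≤ (n : ℤ) ∧ (v = x + j * q ∨ v = y + j * q)})
      ((E \ {s(x, y)}) ∪ {s(x + n * q, y + n * q)}) := by
  induction n with
  | zero =>
    convert h using 1
    · ext v
      simp only [Set.mem_union, Set.mem_ofPred_eq, or_iff_left_iff_imp, Nat.cast_zero]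
      rintro ⟨j, h₁, h₂, -⟩
      omega
    · simpa using he
  | succ n ih =>
    push_cast at hx hy ⊢
    have hinj : ∀ {z i j : ℤ}, z + i * q = z + j * q → i = j := fun h =>
      mul_right_cancel₀ hq.ne' (by linarith)
    refine (ih (fun j h₁ h₂ => hx j h₁ (by omega)) (fun j h₁ h₂ => hy j h₁ (by omega))).insert
      (a := x + n * q) (b := y + n * q) (u := x + (n + 1) * q) (w := y + (n + 1) * q)
      (Or.inr rfl) ?_ ?_
      (integerProjectionGraph_adj_of_sub_eq_right hq (by ring)).symm
      (integerProjectionGraph_adj_of_sub_eq_left hp (by linarith))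
      (integerProjectionGraph_adj_of_sub_eq_right hq (by ring)) ?_ ?_
    · rintro (h' | ⟨j, h₁, h₂, h' | h'⟩)
      · exact hx _ (by omega) le_rfl h'
      · have := hinj h'
        omega
      · exact hdvd ⟨j - (n + 1), by linear_combination h' - hxy⟩
    · rintro (h' | ⟨j, h₁, h₂, h' | h'⟩)
      · exact hy _ (by omega) le_rfl h'
      · exact hdvd ⟨n + 1 - j, by linear_combination -h' - hxy⟩
      · have := hinj h'
        omega
    · intro v
      simp only [Set.mem_union, Set.mem_ofPred_eq, or_assoc]
      refine or_congr_right ?_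
      constructor
      · rintro ⟨j, h₁, h₂, hv⟩
        rcases le_or_gt j n with h' | h'
        · exact Or.inl ⟨j, h₁, h', hv⟩
        · obtain rfl : j = n + 1 := by omega
          exact Or.inr hv
      · rintro (⟨j, h₁, h₂, hv⟩ | hv)
        · exact ⟨j, h₁, by omega, hv⟩
        · exact ⟨n + 1, by omega, le_rfl, hv⟩
    · rintro e (⟨hE, hne⟩ | rfl)
      · refine Or.inl ⟨Or.inl ⟨hE, hne⟩, ?_⟩
        rintro rfl
        rcases Nat.eq_zero_or_pos n with rfl | hn
        · simp at hne
        · exact hx n (by omega) (by omega) (h.mem_of_mem hE (Sym2.mem_mk_left _ _))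
      · exact Or.inr rfl

section Corner

variable {f C : ℤ} {r : ℕ}

theorem HasFullCornerCycle.add_row (hf : 0 < f) (hr : 0 < r) (hcop : IsCoprime f (2 * r))
    (hC : f * (2 * r) - f - 2 * r ≤ C) (h : HasFullCornerCycle f r C) :
    HasFullCornerCycle f r (C + 2 * r) := by
  have hq : (0 : ℤ) < 2 * r := by omega
  -- The lower bound on `C` is just what keeps the last point of the row, `j = 2 * r - 1`,
  -- nonnegative.
  have hcell : ∀ j, j < 2 * (r : ℤ) → 0 ≤ C + 2 * r - j * f := by
    intro j hj
    nlinarith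
  rw [HasFullCornerCycle]
  refine cast ?_ (SimpleGraph.HasCycleOn.insert_row (C := C) hf hq r ?_ h)
  · congr 1
    ext v
    simp only [Set.mem_union, Set.mem_ofPred_eq]
    constructor
    · rintro (⟨h0, hv⟩ | ⟨j, hj, hj', rfl⟩)
      · refine ⟨h0, ?_⟩
        rw [add_sub_right_comm]
        exact hv.add_right
      · exact ⟨hcell j hj', ⟨j, 0, hj, le_rfl, by ring⟩⟩
    · rintro ⟨h0, a, b, ha, hb, hv⟩
      rcases eq_or_lt_of_le hb with rfl | hb
      -- For `a ≥ 2 * r`, trade `2 * r` copies of `f` for `f` copies of `2 * r`, one of which pays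
      -- for the move of the corner.
      · rcases lt_or_ge a (2 * r) with h' | h'
        · exact Or.inr ⟨a, ha, h', by linarith⟩
        · exact Or.inl ⟨h0, a - 2 * r, f - 1, by omega, by omega, by linear_combination hv⟩
      · exact Or.inl ⟨h0, a, b - 1, ha, by omega, by linear_combination hv⟩
  · rintro j hj hj' ⟨-, hv⟩
    rw [show C - (C + 2 * r - j * f) = j * f - 2 * r by ring] at hv
    exact not_isCombination_mul_sub hf hq hcop hj' hv

/-- The corner set wraps around because `f * (2 * r) = (2 * r) * f`: a stack of `f` rungs on the
last alternate edge of the run fills both columns and ends in the edge joining `C + 2 * f` and `C +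
f`, the first edge of the new run. -/
theorem HasFullCornerCycle.add_two_columns (hf : 0 < f) (hr : 0 < r) (hcop : IsCoprime f (2 * r))
    (hC : f * (2 * r) - f - 2 * r ≤ C) (h : HasFullCornerCycle f r C) :
    HasFullCornerCycle f r (C + 2 * f) := by
  have hq : (0 : ℤ) < 2 * r := by omega
  have hdvd : ¬ 2 * (r : ℤ) ∣ f := by
    intro hd
    have := Int.isUnit_iff.mp (hcop.symm.isUnit_of_dvd' dvd_rfl hd)
    omega
  obtain ⟨n, rfl⟩ := Int.eq_ofNat_of_zero_le hf.le
  have hnot : ∀ i a : ℤ, i < n → 1 ≤ a → ¬ IsCombination n (2 * r) (i * (2 * r) - a * n) := by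
    rintro i a hi ha ⟨b, c, hb, hc, h'⟩
    exact not_isCombination_mul_sub (k := i) hq hf hcop.symm hi
      ⟨c, a + b - 1, hc, by omega, by linear_combination h'⟩
  have hpos : ∀ i a : ℤ, i < n → 1 ≤ a → 0 ≤ C + a * n - i * (2 * r) := by
    intro i a hi ha
    nlinarith
  refine cast ?_ ((h.insert_stack (x := C - (2 * r - 2) * n) (y := C - (2 * r - 1) * n) hf hq hdvd
    (by ring) n ?_ ?_ ⟨r - 1, by omega, by omega,
      Sym2.eq_iff.mpr (Or.inl ⟨by ring, by ring⟩)⟩).mono (E' := {e | ∃ k,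
      0 ≤ k ∧ k < (r : ℤ) ∧ e = s(C + 2 * n - 2 * k * n, C + 2 * n - (2 * k + 1) * n)}) ?_)
  · rw [HasFullCornerCycle]
    congr 1
    ext v
    simp only [Set.mem_union, Set.mem_ofPred_eq]
    constructor
    · rintro (⟨h0, hv⟩ | ⟨j, hj, hj', rfl | rfl⟩)
      · refine ⟨h0, ?_⟩
        have := hv.add_left.add_left
        rwa [show C - v + n + n = C + 2 * n - v by ring] at this
      · refine ⟨?_, 0, n - j, le_rfl, by omega, by ring⟩
        have := hpos (n - j) 2 (by omega) (by omega)
        linarith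
      · refine ⟨?_, 1, n - j, by omega, by omega, by ring⟩
        have := hpos (n - j) 1 (by omega) (by omega)
        linarith
    · rintro ⟨h0, a, b, ha, hb, hv⟩
      by_cases ha2 : 2 ≤ a
      · exact Or.inl ⟨h0, a - 2, b, by omega, hb, by linear_combination hv⟩
      by_cases hbn : n ≤ b
      · exact Or.inl ⟨h0, a + 2 * r - 2, b - n, by omega, by omega, by linear_combination hv⟩
      obtain rfl | rfl : a = 0 ∨ a = 1 := by omega
      · exact Or.inr ⟨n - b, by omega, by omega, Or.inl (by linear_combination -hv)⟩
      · exact Or.inr ⟨n - b, by omega, by omega, Or.inr (by linear_combination -hv)⟩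
  · rintro j hj hj' ⟨-, hv⟩
    refine hnot (n - j) 2 (by omega) (by omega) ?_
    convert hv using 1
    ring
  · rintro j hj hj' ⟨-, hv⟩
    refine hnot (n - j) 1 (by omega) (by omega) ?_
    convert hv using 1
    ring
  · rintro e ⟨k, hk, hkr, rfl⟩
    rcases eq_or_lt_of_le hk with rfl | hk
    · exact Or.inr (Sym2.eq_iff.mpr (Or.inl ⟨by ring, by ring⟩))
    · refine Or.inl ⟨⟨k - 1, by omega, by omega,
        Sym2.eq_iff.mpr (Or.inl ⟨by ring, by ring⟩)⟩, fun h' => ?_⟩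
      rcases Sym2.eq_iff.mp h' with ⟨h', -⟩ | ⟨h', -⟩
      · have : 2 * k = 2 * r := mul_right_cancel₀ hf.ne' (by linarith)
        omega
      · have : 2 * k = 2 * r + 1 := mul_right_cancel₀ hf.ne' (by linarith)
        omega

/-- The corner of a full corner cycle can be moved by any even element of the semigroup. -/
theorem HasFullCornerCycle.add_even_combination (hf : 0 < f) (hr : 0 < r)
    (hcop : IsCoprime f (2 * r)) (hC : f * (2 * r) - f - 2 * r ≤ C)
    (h : HasFullCornerCycle f r C) {d : ℤ} (hd : IsCombination f (2 * r) d) (heven : Even d) :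
    HasFullCornerCycle f r (C + d) := by
  have hfodd : ¬ Even f := by
    rintro ⟨g, hg⟩
    have := Int.isUnit_iff.mp (hcop.isUnit_of_dvd' (x := 2) ⟨g, by omega⟩ ⟨r, rfl⟩)
    omega
  obtain ⟨a, b, ha, hb, rfl⟩ := hd
  have ha2 : Even a := by
    rw [Int.even_add, Int.even_mul, Int.even_mul, Int.even_mul] at heven
    simp only [even_two, true_or, or_true, iff_true, hfodd, or_false] at heven
    exact heven
  obtain ⟨c, rfl⟩ := ha2
  obtain ⟨c, rfl⟩ := Int.eq_ofNat_of_zero_le (show 0 ≤ c by omega)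
  obtain ⟨b, rfl⟩ := Int.eq_ofNat_of_zero_le hb
  have hrow : HasFullCornerCycle f r (C + b * (2 * r)) := by
    clear heven hb
    induction b with
    | zero => simpa using h
    | succ b ih =>
      have hb : (0 : ℤ) ≤ b * (2 * r) := by positivity
      convert ih.add_row hf hr hcop (by omega) using 1
      push_cast
      ring
  have hCb : f * (2 * r) - f - 2 * r ≤ C + b * (2 * r) := by
    have : (0 : ℤ) ≤ b * (2 * r) := by positivity
    omega
  clear heven ha
  induction c with
  | zero => simpa using hrow
  | succ c ih =>
    have hc : (0 : ℤ) ≤ (c + c) * f := by positivity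
    convert ih.add_two_columns hf hr hcop (by linarith) using 1
    push_cast
    ring

/-- Two full corner cycles, one of them rotated by a half turn, fit together. -/
theorem HasFullCornerCycle.glue (hf : 0 < f) (hr : 0 < r) (hcop : IsCoprime f (2 * r))
    {D : ℤ} (hC : f * (2 * r) - f - 2 * r ≤ C) (hD : f * (2 * r) - f - 2 * r ≤ D)
    (h₁ : HasFullCornerCycle f r C) (h₂ : HasFullCornerCycle f r D) :
    (integerProjectionGraph f (2 * r)).HasCycleOn
      {v | 0 ≤ v ∧ v < C + D + 1 - (f * (2 * r) - f - 2 * r)} ∅ := by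
  have hq : (0 : ℤ) < 2 * r := by omega
  set F := f * (2 * r) - f - 2 * r with hF
  -- The half turn sends `D - v` to `F - (C - x)`, so by the symmetry of the semigroup the image is
  -- the part of the complement of `C - S` up to `C + D - F`.
  have h₃ := h₂.image (H := integerProjectionGraph f (2 * r)) (fun v => C + D - F - v)
    (fun x _ y _ hxy => by simpa using hxy) (by
      rintro x - y - ⟨hne, h⟩
      refine ⟨fun h' => hne (by simpa using h'), ?_⟩
      rw [show C + D - F - x - (C + D - F - y) = -(x - y) by ring, abs_neg]
      exact h)
  have hmem : ∀ x, x ∈ (fun v => C + D - F - v) '' {v | 0 ≤ v ∧ IsCombination f (2 * r) (D - v)} ↔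
      x ≤ C + D - F ∧ IsCombination f (2 * r) (F - (C - x)) := by
    intro x
    constructor
    · rintro ⟨v, ⟨h0, hv⟩, rfl⟩
      refine ⟨by dsimp only; omega, ?_⟩
      convert hv using 1
      ring
    · rintro ⟨h0, hx⟩
      refine ⟨C + D - F - x, ⟨by omega, ?_⟩, by ring⟩
      convert hx using 1
      ring
  refine SimpleGraph.HasCycleOn.merge h₁ h₃ (a := C) (b := C - f) (c := C + 2 * r)
    (d := C - f + 2 * r) ?_ ⟨0, le_rfl, by omega, by simp⟩ ?_
    (integerProjectionGraph_adj_of_sub_eq_right hq (by ring)).symm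
    (integerProjectionGraph_adj_of_sub_eq_right hq (by ring)).symm ?_ (fun e he => he.elim)
  · intro x hx hx'
    exact hx'.2.not_sub hf hq hcop ((hmem x).mp hx).2
  -- The half turn carries the last alternate edge at `D` to the edge opposite the first one at `C`.
  · refine ⟨_, ⟨r - 1, by omega, by omega, rfl⟩, ?_⟩
    rw [Sym2.map_mk, Sym2.eq_swap]
    congr 2 <;> rw [hF] <;> ring
  · intro x
    rw [hmem]
    simp only [Set.mem_ofPred_eq]
    constructor
    · rintro ⟨h0, hx⟩
      rcases isCombination_or_isCombination_sub hq hcop (C - x) with h | h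
      · exact Or.inl ⟨h0, h⟩
      · exact Or.inr ⟨by omega, h⟩
    · rintro (⟨h0, hx⟩ | ⟨h0, hx⟩)
      · refine ⟨h0, ?_⟩
        by_contra! hlt
        exact hx.not_sub hf hq hcop (isCombination_of_lt hf hq hcop (by omega))
      · refine ⟨?_, by omega⟩
        by_contra! hlt
        exact (isCombination_of_lt hf hq hcop (x := C - x) (by omega)).not_sub hf hq hcop hx

end Corner

/-! ### All sufficiently long intervals, and the bound. -/

section Assembly

variable {f m C : ℤ} {r : ℕ}

theorem HasCornerCycle.hasFullCornerCycle (hf : 0 < f) (hr : 0 < r) (hcop : IsCoprime f (2 * r))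
    (hC : f * (2 * r) - f - 2 * r ≤ C - m) (h : HasCornerCycle f (2 * r) m C) :
    HasFullCornerCycle f r C := by
  rw [HasFullCornerCycle]
  refine cast ?_ (h.mono (E' := {e | ∃ k, 0 ≤ k ∧ k < (r : ℤ) ∧
    e = s(C - 2 * k * f, C - (2 * k + 1) * f)}) ?_)
  · congr 1
    ext v
    simp only [cornerSet, Set.mem_ofPred_eq]
    refine and_congr_right fun _ => or_iff_right_of_imp fun hv => ?_
    exact isCombination_of_lt hf (by omega) hcop (by omega)
  · rintro e ⟨k, hk, hkr, rfl⟩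
    refine Or.inl ⟨k, hk, by omega, ?_, rfl⟩
    nlinarith

theorem HasCornerCycle.add_layer (hf : 0 < f) (hr : 0 < r) (hcop : IsCoprime f (2 * r))
    (hm : 0 ≤ m) (hC : f * (2 * r) - f - 2 * r ≤ C - m) (h : HasCornerCycle f (2 * r) m C) :
    HasCornerCycle f (2 * r) (m + (f + 2 * r)) (C + (f + 2 * r)) := by
  have hmC : m ≤ C - f + 2 * r := by
    nlinarith
  refine HasCornerCycle.of_hasCycleOn hf (by omega) (by omega) hcop hm hmC (by omega) (h.mono ?_)
  rintro _ rfl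
  exact Or.inl ⟨0, le_rfl, by omega, by linarith, by simp⟩

theorem HasCornerCycle.hasCycleOn_interval (hf : 0 < f) (hr : 0 < r)
    (hcop : IsCoprime f (2 * r)) (hfodd : Odd f) (hm : 0 ≤ m)
    (hC : f * (2 * r) - f - 2 * r ≤ C - m) (h : HasCornerCycle f (2 * r) m C) {n : ℤ}
    (hn : 2 * C + 2 + (f + 2 * r) ≤ n) :
    (integerProjectionGraph f (2 * r)).HasCycleOn {v | 0 ≤ v ∧ v < n} ∅ := by
  have h₁ := h.hasFullCornerCycle hf hr hcop hC
  have h₂ := (h.add_layer hf hr hcop hm hC).hasFullCornerCycle hf hr hcop (by omega)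
  have hcomb : ∀ d, f * (2 * r) - f - 2 * r < d → IsCombination f (2 * r) d := fun d =>
    isCombination_of_lt hf (by omega) hcop
  have hpos : ∀ d, f * (2 * r) - f - 2 * r < d → 0 ≤ d := fun d hd =>
    (hcomb d hd).nonneg hf (by omega)
  set F := f * (2 * r) - f - 2 * r with hF
  obtain ⟨g, hg⟩ := hfodd
  -- An even excess `d > F` is an even element of `S` and moves one corner. If it is odd, the other
  -- piece takes the extra layer, which absorbs the odd number `f + 2 * r` and leaves an even excess
  -- still above `F`.
  rcases Int.even_or_odd (n - (2 * C + 1 - F)) with hd | hd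
  · have := (h₁.add_even_combination hf hr hcop (by omega) (hcomb _ (by omega)) hd).glue hf hr
      hcop (by have := hpos _ (show F < n - (2 * C + 1 - F) by omega); omega) (by omega) h₁
    rw [← hF] at this
    convert this using 5
    ring
  · have hd' : Even (n - (2 * C + 1 - F) - (f + 2 * r)) := by
      obtain ⟨a, ha⟩ := hd
      exact ⟨a - g - r, by omega⟩
    have := (h₁.add_even_combination hf hr hcop (by omega) (hcomb _ (by omega)) hd').glue hf hr
      hcop (by have := hpos _ (show F < n - (2 * C + 1 - F) - (f + 2 * r) by omega); omega)
      (by omega) h₂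
    rw [← hF] at this
    convert this using 5
    ring

end Assembly

theorem hasCycleOn_interval {p q n : ℤ} (hp : 0 < p) (hpq : p < q) (hcop : IsCoprime p q)
    (hodd : Odd (p + q)) (hn : 6 * q ^ 2 - 1 ≤ n) :
    (integerProjectionGraph p q).HasCycleOn {v | 0 ≤ v ∧ v < n} ∅ := by
  have hq : 0 < q := by omega
  obtain ⟨K, c, hK0, hK, hc₁, hc₂, h⟩ := exists_hasCornerCycle hp hpq hcop hodd
  have hm : 0 ≤ K * (p + q) := mul_nonneg hK0 (by omega)
  -- The left side is at most `(p + q) * (p + q + 2) + 2 * p * q`, which for `p ≤ q - 1` is at most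
  -- `6 * q ^ 2 - 2 * q - 1`.
  have hbound : 2 * (K * (p + q) + c) + 2 + (p + q) ≤ n := by
    have h₁ : 2 * K * (p + q) ≤ (p + q + 1) * (p + q) :=
      mul_le_mul_of_nonneg_right hK (by omega)
    nlinarith
  rcases Int.even_or_odd q with hq2 | hq2
  · obtain ⟨r, hr⟩ := hq2
    obtain ⟨r, rfl⟩ := Int.eq_ofNat_of_zero_le (show 0 ≤ r by omega)
    obtain rfl : q = 2 * r := by omega
    refine h.hasCycleOn_interval hp (by omega) hcop ?_ hm (by omega) hbound
    exact (Int.odd_add.mp hodd).mpr (even_two_mul _)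
  · have hp2 : Even p := by
      rw [add_comm] at hodd
      exact (Int.odd_add.mp hodd).mp hq2
    obtain ⟨r, hr⟩ := hp2
    obtain ⟨r, rfl⟩ := Int.eq_ofNat_of_zero_le (show 0 ≤ r by omega)
    obtain rfl : p = 2 * r := by omega
    rw [integerProjectionGraph_comm]
    exact h.swap.hasCycleOn_interval hq (by omega) hcop.symm hq2 hm (by linarith) (by linarith)

theorem projectionGraph_isHamiltonian {p q n : ℕ} (hp : 0 < p) (hpq : p < q)
    (hcop : Nat.Coprime p q) (hodd : Odd (p + q)) (hn : 6 * q ^ 2 - 1 ≤ n) :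
    (projectionGraph p q n).IsHamiltonian := by
  have hq : 1 ≤ q ^ 2 := Nat.one_le_pow _ _ (by omega)
  have h := hasCycleOn_interval (p := p) (q := q) (n := n) (by exact_mod_cast hp)
    (by exact_mod_cast hpq) (Nat.isCoprime_iff_coprime.mpr hcop) (by exact_mod_cast hodd)
    (by zify [show 1 ≤ 6 * q ^ 2 by omega] at hn; exact hn)
  have hn0 : 0 < n := by omega
  -- Reduction modulo `n` only makes the map to `Fin n` total; on the interval it changes nothing.
  have hval : ∀ v : ℤ, 0 ≤ v ∧ v < n → ((v.toNat % n : ℕ) : ℤ) = v := by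
    intro v hv
    rw [Nat.mod_eq_of_lt (by omega)]
    omega
  have h' := h.image (H := projectionGraph p q n)
    (fun v => ⟨v.toNat % n, Nat.mod_lt _ hn0⟩) ?_ ?_
  · refine SimpleGraph.HasCycleOn.isHamiltonian (E := ∅) ?_
    convert h' using 1
    · refine (Set.eq_univ_of_forall fun x => ?_).symm
      refine ⟨(x : ℕ), ⟨by omega, by exact_mod_cast x.2⟩, ?_⟩
      ext
      simpa using Nat.mod_eq_of_lt x.2
    · simp
  · intro x hx y hy hxy
    rw [← hval x hx, ← hval y hy]
    exact_mod_cast congrArg Fin.val hxy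
  · rintro x hx y hy ⟨hne, hxy⟩
    refine ⟨fun h => hne ?_, ?_⟩
    · rw [← hval x hx, ← hval y hy]
      exact_mod_cast congrArg Fin.val h
    · simp only [hval x hx, hval y hy]
      exact hxy

theorem mainTheorem4 (p q : ℕ) (hp : 0 < p) (hpq : p < q) (hcop : Nat.Coprime p q)
    (hodd : Odd (p + q)) :
    (∃ N : ℕ, ∀ n : ℕ, N ≤ n → (projectionGraph p q n).IsHamiltonian) ∧
      ∃ μ : ℕ, IsLeast (hamiltonianThresholds p q) μ ∧ μ < 6 * q ^ 2 := by
  have hq : 1 ≤ q ^ 2 := Nat.one_le_pow _ _ (by omega)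
  -- The threshold one below `6 * q ^ 2` makes the final inequality strict.
  have hmem : 6 * q ^ 2 - 1 ∈ hamiltonianThresholds p q :=
    ⟨by omega, fun n hn => projectionGraph_isHamiltonian hp hpq hcop hodd hn⟩
  refine ⟨⟨_, hmem.2⟩, sInf (hamiltonianThresholds p q),
    ⟨Nat.sInf_mem ⟨_, hmem⟩, fun m hm => Nat.sInf_le hm⟩, ?_⟩
  have := Nat.sInf_le hmem
  omega
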